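/- Fix integers $q\ge 2$, $d\ge 2$ and $0\le w<h$, and let $T_{d,h}$ be the rooted $d$-ary tree of height $h$, whose levels are ordered lexicographically. In the $q$-coloring broadcast process on $T_{d,h}$ the root receives a uniformly random color in $[q]$ and, level by level, every vertex independently receives a uniformly random color different from the color of its parent. The autoregressive coloring process with context depth $w$ produces a word $X_L=(Y_1,\dots,Y_{d^{h-w}})\in[q]^{d^h}$ of leaf colors, in blocks $Y_r\in[q]^{d^w}$ that correspond to the leaves of the successive subtrees of height $w$ rooted at depth $h-w$, as follows. $Y_1$ has the law of the leaf colors of such a subtree in the broadcast process. For $r\ge 2$, given $Y_1,\dots,Y_{r-1}$, one first samples, independently, a height $h_r\in\{1,\dots,h-w\}$ with the law of the height (above depth $h-w$) of the least common ancestor of a uniformly random pair of adjacent subtrees of height $w$ in $T_{d,h}$; then $Y_r$ is sampled from the law, in the broadcast process, of the leaf colors of the second of two adjacent subtrees, conditioned on the leaf colors of the first being $Y_{r-1}$ and on their least common ancestor having height exactly $h_r$. Theorem. There are functions $\varepsilon,\delta:\mathbb N\to\mathbb R$ with $\varepsilon(q)\to 0$ and $\delta(q)\to 0$ as $q\to\infty$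 such that, for all $q\ge 2$, $d\ge 2$ and $0\le w<h$ with $$d>q\bigl(\log q+\log\log q+1+\varepsilon(q)\bigr),$$ the following hold with $X_L$ sampled from the autoregressive coloring process with context depth $w$: (a) with probability at least $1-\delta(q)$, no proper $q$-coloring of $T_{d,h}$ has the leaf colors $X_L$; (b) for every vertex $v$ at depth $h-w-1$, with probability at least $1-\delta(q)$ there is no valid color for $v$: no proper $q$-coloring of the subtree of $T_{d,h}$ rooted at $v$ has the leaf colors that $X_L$ prescribes below $v$. -/

import Mathlib

noncomputable section

namespace Broadcast

/-! ### The rooted `d`-ary tree of height `h`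

The vertices at depth `ℓ` are listed from left to right as `0, 1, …, d ^ ℓ - 1`, that is, a word
`(r₁, …, r_ℓ)` of digits is identified with the number that it represents in base `d`. Removing the
last digit gives the parent, so the parent of the vertex `i` at depth `ℓ + 1` is the vertex `i / d`
at depth `ℓ`, and the ancestor of `i` that lies `m` levels higher is `i / d ^ m`. -/

/-- The index of the parent (at depth `ℓ`) of a vertex at depth `ℓ + 1`. -/
def parent {d ℓ : ℕ} (i : Fin (d ^ (ℓ + 1))) : Fin (d ^ ℓ) :=
  ⟨i / d, Nat.div_lt_of_lt_mul ((i.isLt.trans_eq (pow_succ d ℓ)).trans_eq (mul_comm _ _))⟩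

/-- Vertices of `T_{d,h}`: a depth in `{0, …, h}` and an index within this level. -/
abbrev TreeVertex (d h : ℕ) : Type := Σ ℓ : Fin (h + 1), Fin (d ^ (ℓ : ℕ))

/-- `u` is the parent of `v` in `T_{d,h}`. -/
def IsParent {d h : ℕ} (u v : TreeVertex d h) : Prop :=
  (v.1 : ℕ) = (u.1 : ℕ) + 1 ∧ (u.2 : ℕ) = (v.2 : ℕ) / d

/-- The rooted `d`-ary tree `T_{d,h}` of height `h`, as a graph. -/
def treeGraph (d h : ℕ) : SimpleGraph (TreeVertex d h) where
  Adj u v := IsParent u v ∨ IsParent v u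
  symm := ⟨fun _ _ huv => huv.symm⟩
  loopless := ⟨fun u hu => by
    rcases hu with hu | hu <;> · have := hu.1; omega⟩

/-- The `i`-th leaf of `T_{d,h}`. -/
def leaf {d h : ℕ} (i : Fin (d ^ h)) : TreeVertex d h := ⟨Fin.last h, i⟩

/-- A word of leaf colors is consistent if some proper `q`-coloring of `T_{d,h}` has these colors
at its leaves. -/
def Consistent {d h q : ℕ} (z : Fin (d ^ h) → Fin q) : Prop :=
  ∃ C : (treeGraph d h).Coloring (Fin q), ∀ i, C (leaf i) = z i

/-- The leaves of `T_{d,h}` below the `r`-th vertex at depth `h - w` are the leaves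
`r * d ^ w + j`, `j < d ^ w`; this is the `j`-th one. -/
def subtreeLeaf {d h w : ℕ} (hw : w ≤ h) (r : Fin (d ^ (h - w))) (j : Fin (d ^ w)) :
    Fin (d ^ h) :=
  ⟨r * d ^ w + j, by
    have h1 : d ^ (h - w) * d ^ w = d ^ h := by rw [← pow_add, Nat.sub_add_cancel hw]
    calc (r : ℕ) * d ^ w + j < (r : ℕ) * d ^ w + d ^ w := by have := j.isLt; omega
      _ = ((r : ℕ) + 1) * d ^ w := by ring
      _ ≤ d ^ (h - w) * d ^ w := Nat.mul_le_mul_right _ r.isLt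
      _ = d ^ h := h1⟩

/-- The restriction of a word on the leaves of `T_{d,h}` to the leaves of the subtree (a copy of
`T_{d,w}`) rooted at the `r`-th vertex at depth `h - w`. -/
def block {σ : Type*} {d h w : ℕ} (hw : w ≤ h) (r : Fin (d ^ (h - w)))
    (z : Fin (d ^ h) → σ) : Fin (d ^ w) → σ :=
  fun j => z (subtreeLeaf hw r j)

/-- The concatenation of `d ^ (h - w)` words of length `d ^ w` to a word on the leaves of
`T_{d,h}`. -/
def concat {σ : Type*} {d h w : ℕ} (hw : w ≤ h)
    (Y : Fin (d ^ (h - w)) → Fin (d ^ w) → σ) : Fin (d ^ h) → σ :=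
  have hpow : d ^ h = d ^ w * d ^ (h - w) := by rw [← pow_add, Nat.add_sub_cancel' hw]
  fun i => Y ⟨i / d ^ w, Nat.div_lt_of_lt_mul (i.isLt.trans_eq hpow)⟩
    ⟨i % d ^ w, Nat.mod_lt _ (Nat.pos_of_mul_pos_right
      ((Nat.zero_le _).trans_lt (i.isLt.trans_eq hpow)))⟩

/-- The height, above their common level, of the least common ancestor of the vertices `i` and `j`
of the same level (a well-defined minimum when `d ≥ 2`). -/
def lcaHeight (d i j : ℕ) : ℕ := sInf {m : ℕ | i / d ^ m = j / d ^ m}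

/-! ### The broadcast process -/

open Classical in
/-- The law of independent samples `f i ∼ p i`. -/
def piPMF {ι σ : Type*} [Fintype ι] [Fintype σ] (p : ι → PMF σ) : PMF (ι → σ) :=
  PMF.ofFintype (fun f => ∏ i, p i (f i)) (by
    have h1 : ∀ i, ∑ a, p i a = 1 := fun i => (tsum_fintype (p i)).symm.trans (p i).tsum_coe
    have h2 := Finset.prod_univ_sum (fun _ : ι => (Finset.univ : Finset σ)) (fun i a => p i a)
    rw [Fintype.piFinset_univ] at h2
    rw [← h2]
    exact Finset.prod_eq_one fun i _ => h1 i)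

/-- The law of the tokens at depth `h` in the broadcast process on the `d`-ary tree with
channel `κ` and prior `ν`: the root has law `ν`, and given the tokens at depth `ℓ`, the tokens at
depth `ℓ + 1` are independent, each distributed according to the channel applied to its parent.
This is the `(d,h,κ,ν)`-language, a distribution on words of length `d ^ h`. -/
def language {σ : Type*} [Fintype σ] (d : ℕ) (κ : σ → PMF σ) (ν : PMF σ) :
    (h : ℕ) → PMF (Fin (d ^ h) → σ)
  | 0 => ν.map fun a _ => a
  | h + 1 => (language d κ ν h).bind fun x => piPMF fun i => κ (x (parent i))

/-! ### The autoregressive broadcast process -/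

/-- There are at least two vertices at every positive depth. -/
theorem one_lt_pow_sub {d h w : ℕ} (hd : 2 ≤ d) (hw : w < h) : 1 < d ^ (h - w) :=
  Nat.one_lt_pow (Nat.sub_ne_zero_of_lt hw) hd

/-- A uniformly random `i` such that `i` and `i + 1` are adjacent vertices at depth `h - w`. -/
def adjacentLaw {d h w : ℕ} (hd : 2 ≤ d) (hw : w < h) : PMF (Fin (d ^ (h - w) - 1)) :=
  haveI : Nonempty (Fin (d ^ (h - w) - 1)) :=
    ⟨⟨0, Nat.sub_pos_of_lt (one_lt_pow_sub hd hw)⟩⟩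
  PMF.uniformOfFintype _

/-- The law on `{1, …, h - w}` of the height of the least common ancestor of a uniformly random
pair of adjacent subtrees of height `w` in `T_{d,h}`. -/
def heightLaw {d h w : ℕ} (hd : 2 ≤ d) (hw : w < h) : PMF ℕ :=
  (adjacentLaw hd hw).map fun i => lcaHeight d i (i + 1)

/-- The joint law of `(m, Y, Y')`, where `Y` and `Y'` are the leaves, in a sample of the broadcast
process on `T_{d,h}`, of a uniformly random pair of adjacent subtrees of height `w`, and `m` is the
height of the least common ancestor of these two subtrees. -/
def adjacentBlocksLaw {σ : Type*} [Fintype σ] {d h w : ℕ} (κ : σ → PMF σ) (ν : PMF σ)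
    (hd : 2 ≤ d) (hw : w < h) : PMF (ℕ × (Fin (d ^ w) → σ) × (Fin (d ^ w) → σ)) :=
  (adjacentLaw hd hw).bind fun i => (language d κ ν h).map fun z =>
    (lcaHeight d i (i + 1),
      block hw.le ⟨i, by have := i.isLt; omega⟩ z,
      block hw.le ⟨i + 1, by have := i.isLt; omega⟩ z)

/-- The marginal of the broadcast process on the leaves of the first subtree of height `w`. -/
def firstBlockLaw {σ : Type*} [Fintype σ] {d h w : ℕ} (κ : σ → PMF σ) (ν : PMF σ)
    (hd : 2 ≤ d) (hw : w < h) : PMF (Fin (d ^ w) → σ) :=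
  (language d κ ν h).map
    (block hw.le ⟨0, (Nat.zero_lt_one.trans (one_lt_pow_sub hd hw))⟩)

open Classical in
/-- One step of the autoregressive broadcast process: given the previous block `y`, sample a height
`m`, then the next block from the broadcast process conditioned on the previous block being `y` and
on the two adjacent subtrees having their least common ancestor at height exactly `m`. (If this
condition has probability zero, which for a stationary prior happens only for words `y` that the
process never produces, the value is immaterial.) -/
def nextBlockLaw {σ : Type*} [Fintype σ] {d h w : ℕ} (κ : σ → PMF σ) (ν : PMF σ)
    (hd : 2 ≤ d) (hw : w < h) (y : Fin (d ^ w) → σ) : PMF (Fin (d ^ w) → σ) :=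
  (heightLaw hd hw).bind fun m =>
    if hm : ∃ t ∈ {t : ℕ × (Fin (d ^ w) → σ) × (Fin (d ^ w) → σ) | t.1 = m ∧ t.2.1 = y},
        t ∈ (adjacentBlocksLaw κ ν hd hw).support then
      ((adjacentBlocksLaw κ ν hd hw).filter _ hm).map fun t => t.2.2
    else firstBlockLaw κ ν hd hw

/-- The law of the first `n` blocks `(Y₁, …, Y_n)` of a process with initial law `μ` and
transition kernel `K`. -/
def chainLaw {B : Type*} (μ : PMF B) (K : B → PMF B) : (n : ℕ) → PMF (Fin n → B)
  | 0 => PMF.pure Fin.elim0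
  | 1 => μ.map fun b _ => b
  | n + 2 => (chainLaw μ K (n + 1)).bind fun Y =>
      (K (Y (Fin.last n))).map fun b => Fin.snoc (α := fun _ => B) Y b

/-- The law of the word on the `d ^ h` leaves produced by the autoregressive broadcast process with
context depth `w`. -/
def autoregressiveLaw {σ : Type*} [Fintype σ] {d h w : ℕ} (κ : σ → PMF σ) (ν : PMF σ)
    (hd : 2 ≤ d) (hw : w < h) : PMF (Fin (d ^ h) → σ) :=
  (chainLaw (firstBlockLaw κ ν hd hw) (nextBlockLaw κ ν hd hw) (d ^ (h - w))).map
    (concat hw.le)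

/-! ### Colorings -/

/-- The coloring channel: a uniformly random color different from `a`. -/
def coloringChannel {q : ℕ} (hq : 2 ≤ q) (a : Fin q) : PMF (Fin q) :=
  PMF.uniformOfFinset (Finset.univ.erase a) (by
    rw [← Finset.card_pos, Finset.card_erase_of_mem (Finset.mem_univ a), Finset.card_univ,
      Fintype.card_fin]
    omega)

/-- The uniform prior on `q` colors. -/
def coloringPrior {q : ℕ} (hq : 2 ≤ q) : PMF (Fin q) :=
  haveI : Nonempty (Fin q) := ⟨⟨0, by omega⟩⟩
  PMF.uniformOfFintype (Fin q)

/-- The autoregressive coloring broadcast process with `q` colors and context depth `w`. -/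
def autoregressiveColoringLaw {q d h w : ℕ} (hq : 2 ≤ q) (hd : 2 ≤ d) (hw : w < h) :
    PMF (Fin (d ^ h) → Fin q) :=
  autoregressiveLaw (coloringChannel hq) (coloringPrior hq) hd hw

/-- The probability of an event, as a real number. -/
def prob {α : Type*} (p : PMF α) (s : Set α) : ℝ := (p.toOuterMeasure s).toReal

end Broadcast

end

noncomputable section

namespace Broadcast

/-! ### Product laws on finite index sets. -/

section Product

variable {ι σ τ : Type*} [Fintype ι] [Fintype σ] [Fintype τ]

/-! The threshold is the one above which broadcast leaves usually freeze the color of the root. If a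
vertex fails to be frozen with probability at most `x`, then each child, independently, is frozen to
a given color `b` other than the root's with probability at least `(1 - x) / q`. A root that is not
frozen leaves some such `b` to which no child is frozen, so a union bound gives failure probability
at most `q (1 - (1 - x) / q) ^ d` one level up. For large `q`, this is at most `x` when `x = 1 / log
q`, at every height (`not_determinesRoot_le`).

The autoregressive process sees only the previous block, but two distinct vertices of the same level
have any prescribed pair of colors with probability at least `twoStep q / q`, however far apart they
are (`le_language_map_pair`). Blocks are conditionally independent given their roots, so whatever
the previous block was, the next one freezes its root to `b` with probability at least `twoStep q *
(1 - x)`, for every `b` (`le_nextBlockLaw`). In the true broadcast process the parent's own color is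
never used by its children; here no color is protected.

Hence the `d` blocks below a vertex at depth `h - w - 1` all miss the color `b` with probability at
most `(1 - twoStep q * (1 - x)) ^ d` (`chainLaw_avoid_le`). A valid color for that vertex must be
missed in this way, and summing over `b` yields `O(1 / log q)` (`consistent_block_le`). This is (b).
It implies (a), because a coloring of the whole tree restricts to subtrees. -/

theorem piPMF_apply (p : ι → PMF σ) (f : ι → σ) : piPMF p f = ∏ i, p i (f i) := rfl

theorem piPMF_pure (g : ι → σ) : piPMF (fun i => PMF.pure (g i)) = PMF.pure g := by
  classical
  ext f
  rw [piPMF_apply, PMF.pure_apply]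
  by_cases hfg : f = g
  · subst hfg
    simp
  · obtain ⟨i, hi⟩ := Function.ne_iff.1 hfg
    rw [if_neg hfg]
    exact Finset.prod_eq_zero (Finset.mem_univ i) (by rw [PMF.pure_apply, if_neg hi])

/-- Distributivity of the product over sums: coordinates that evolve separately stay independent. -/
theorem piPMF_bind (p : ι → PMF σ) (G : σ → PMF τ) :
    (piPMF p).bind (fun f => piPMF fun i => G (f i)) = piPMF fun i => (p i).bind G := by
  classical
  ext g
  simp only [PMF.bind_apply, piPMF_apply, tsum_fintype]
  rw [Finset.prod_univ_sum, Fintype.piFinset_univ]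
  simp only [Finset.prod_mul_distrib]

theorem piPMF_map_curry {α β : Type*} [Fintype α] [Fintype β] [DecidableEq β]
    (φ : α × β ≃ ι) (p : ι → PMF σ) :
    (piPMF p).map (fun z r j => z (φ (r, j))) = piPMF fun r => piPMF fun j => p (φ (r, j)) := by
  classical
  ext g
  rw [PMF.map_apply, tsum_eq_single (fun i => g (φ.symm i).1 (φ.symm i).2)]
  · simp only [Equiv.symm_apply_apply, if_true, piPMF_apply]
    rw [← Fintype.prod_prod_type', ← φ.prod_comp]
    simp
  · intro z hz
    rw [if_neg]
    rintro rfl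
    exact hz (by simp)

/-- The probability of a product event under a product law. -/
theorem piPMF_toOuterMeasure_pi (p : ι → PMF σ) (A : ι → Set σ) :
    (piPMF p).toOuterMeasure (Set.univ.pi A) = ∏ i, (p i).toOuterMeasure (A i) := by
  classical
  simp only [PMF.toOuterMeasure_apply, tsum_fintype]
  rw [Finset.prod_univ_sum, Fintype.piFinset_univ]
  refine Finset.sum_congr rfl fun f _ => ?_
  by_cases hf : f ∈ Set.univ.pi A
  · rw [Set.indicator_of_mem hf, piPMF_apply]
    exact Finset.prod_congr rfl fun i _ => (Set.indicator_of_mem (hf i (Set.mem_univ i)) _).symm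
  · rw [Set.indicator_of_notMem hf]
    simp only [Set.mem_pi, Set.mem_univ, true_implies, not_forall] at hf
    obtain ⟨i, hi⟩ := hf
    exact (Finset.prod_eq_zero (Finset.mem_univ i) (Set.indicator_of_notMem hi _)).symm

theorem map_apply_eq_toOuterMeasure {α β : Type*} (p : PMF α) (g : α → β) (b : β) :
    p.map g b = p.toOuterMeasure (g ⁻¹' {b}) := by
  rw [← PMF.toOuterMeasure_map_apply, PMF.toOuterMeasure_apply_singleton]

theorem piPMF_map_eval (p : ι → PMF σ) (i : ι) : (piPMF p).map (fun f => f i) = p i := by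
  classical
  ext u
  have hpre : (fun f : ι → σ => f i) ⁻¹' {u}
      = Set.univ.pi (fun k => if k = i then {u} else Set.univ) := by
    ext f
    simp only [Set.mem_preimage, Set.mem_singleton_iff, Set.mem_pi, Set.mem_univ, true_implies]
    refine ⟨fun hf k => ?_, fun hf => by simpa using hf i⟩
    split_ifs with hk
    · subst hk; exact hf
    · trivial
  rw [map_apply_eq_toOuterMeasure, hpre, piPMF_toOuterMeasure_pi,
    Fintype.prod_eq_single i, if_pos rfl, PMF.toOuterMeasure_apply_singleton]
  intro k hk
  rw [if_neg hk, PMF.toOuterMeasure_apply_eq_one_iff]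
  exact Set.subset_univ _

theorem bind_pair_apply {α τ : Type*} (p : PMF α) (r : PMF τ) (u : α) (v : τ) :
    (p.bind fun u => r.map fun v => (u, v)) (u, v) = p u * r v := by
  classical
  rw [PMF.bind_apply, tsum_eq_single u]
  · rw [map_apply_eq_toOuterMeasure,
      show (fun v' => (u, v')) ⁻¹' {(u, v)} = {v} by ext; simp,
      PMF.toOuterMeasure_apply_singleton]
  · intro u' hu'
    rw [map_apply_eq_toOuterMeasure,
      show (fun v' => (u', v')) ⁻¹' {(u, v)} = ∅ by ext; simp [hu'], MeasureTheory.measure_empty,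
      mul_zero]

theorem piPMF_map_pair (p : ι → PMF σ) {i j : ι} (hij : i ≠ j) :
    (piPMF p).map (fun f => (f i, f j)) = (p i).bind fun u => (p j).map fun v => (u, v) := by
  classical
  ext ⟨u, v⟩
  have hpre : (fun f : ι → σ => (f i, f j)) ⁻¹' {(u, v)}
      = Set.univ.pi (fun k => if k = i then {u} else if k = j then {v} else Set.univ) := by
    ext f
    simp only [Set.mem_preimage, Set.mem_singleton_iff, Set.mem_pi, Set.mem_univ, true_implies,
      Prod.mk.injEq]
    refine ⟨fun hf k => ?_, fun hf => ⟨by simpa using hf i, by simpa [hij.symm] using hf j⟩⟩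
    split_ifs with hk hk'
    · subst hk; exact hf.1
    · subst hk'; exact hf.2
    · trivial
  rw [map_apply_eq_toOuterMeasure, hpre, piPMF_toOuterMeasure_pi, Fintype.prod_eq_mul i j hij]
  · rw [if_pos rfl, if_neg hij.symm, if_pos rfl, PMF.toOuterMeasure_apply_singleton,
      PMF.toOuterMeasure_apply_singleton, bind_pair_apply]
  · rintro k ⟨hk, hk'⟩
    rw [if_neg hk, if_neg hk', PMF.toOuterMeasure_apply_eq_one_iff]
    exact Set.subset_univ _

end Product

/-! ### Complements and conditioning. -/

section Pmf

variable {α β : Type*}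

theorem toOuterMeasure_add_compl (p : PMF α) (s : Set α) :
    p.toOuterMeasure s + p.toOuterMeasure sᶜ = 1 := by
  rw [PMF.toOuterMeasure_apply, PMF.toOuterMeasure_apply, ← ENNReal.tsum_add, ← p.tsum_coe]
  exact tsum_congr fun a => Set.indicator_self_add_compl_apply s p a

theorem toOuterMeasure_le_one (p : PMF α) (s : Set α) : p.toOuterMeasure s ≤ 1 :=
  (toOuterMeasure_add_compl p s).le.trans' le_self_add

theorem toOuterMeasure_compl (p : PMF α) (s : Set α) :
    p.toOuterMeasure sᶜ = 1 - p.toOuterMeasure s := by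
  have hs : p.toOuterMeasure s ≠ ⊤ := ne_top_of_le_ne_top ENNReal.one_ne_top
    (toOuterMeasure_le_one p s)
  exact ENNReal.eq_sub_of_add_eq hs (by rw [add_comm, toOuterMeasure_add_compl])

theorem le_toOuterMeasure_of_compl_le {p : PMF α} {s : Set α} {ε : ENNReal}
    (h : p.toOuterMeasure sᶜ ≤ ε) : 1 - ε ≤ p.toOuterMeasure s := by
  rw [tsub_le_iff_right, ← toOuterMeasure_add_compl p s]
  gcongr

/-- A conditional probability is at least `c` if the joint probability is at least `c` times
that of the condition. -/
theorem le_filter_map_toOuterMeasure (p : PMF α) (s : Set α) (hs : ∃ a ∈ s, a ∈ p.support)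
    (g : α → β) (F : Set β) (c : ENNReal)
    (h : c * p.toOuterMeasure s ≤ p.toOuterMeasure (s ∩ g ⁻¹' F)) :
    c ≤ ((p.filter s hs).map g).toOuterMeasure F := by
  have h0 : p.toOuterMeasure s ≠ 0 := by
    obtain ⟨a, ha, hp⟩ := hs
    rw [Ne, PMF.toOuterMeasure_apply_eq_zero_iff, Set.not_disjoint_iff]
    exact ⟨a, hp, ha⟩
  have h1 : p.toOuterMeasure s ≠ ⊤ := ne_top_of_le_ne_top ENNReal.one_ne_top
    (toOuterMeasure_le_one p s)
  have key : ((p.filter s hs).map g).toOuterMeasure F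
      = p.toOuterMeasure (s ∩ g ⁻¹' F) * (p.toOuterMeasure s)⁻¹ := by
    rw [PMF.toOuterMeasure_map_apply]
    simp only [PMF.toOuterMeasure_apply]
    rw [← ENNReal.tsum_mul_right]
    refine tsum_congr fun a => ?_
    by_cases ha : a ∈ g ⁻¹' F
    · rw [Set.indicator_of_mem ha, PMF.filter_apply]
      congr 1
      by_cases ha' : a ∈ s
      · rw [Set.indicator_of_mem ha', Set.indicator_of_mem (show a ∈ s ∩ g ⁻¹' F from ⟨ha', ha⟩)]
      · rw [Set.indicator_of_notMem ha',
          Set.indicator_of_notMem (show a ∉ s ∩ g ⁻¹' F from fun hh => ha' hh.1)]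
    · rw [Set.indicator_of_notMem ha,
        Set.indicator_of_notMem (show a ∉ s ∩ g ⁻¹' F from fun hh => ha hh.2), zero_mul]
  rw [key, ← div_eq_mul_inv, ENNReal.le_div_iff_mul_le (Or.inl h0) (Or.inl h1)]
  exact h

end Pmf

/-! ### Avoidance probabilities for Markov chains. -/

section Chain

variable {B : Type*}

/-- If every transition avoids `F` with probability at most `ρ`, whatever the past, then all the
times in `S` avoid `F` with probability at most `ρ ^ #S`. -/
theorem chainLaw_avoid_le {μ : PMF B} {K : B → PMF B} {F : Set B} {ρ : ENNReal}
    (hμ : μ.toOuterMeasure Fᶜ ≤ ρ) (hK : ∀ y, (K y).toOuterMeasure Fᶜ ≤ ρ) (S : Finset ℕ) :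
    ∀ n, (chainLaw μ K n).toOuterMeasure {Y | ∀ r : Fin n, (r : ℕ) ∈ S → Y r ∉ F}
      ≤ ρ ^ (S.filter (· < n)).card
  | 0 => (toOuterMeasure_le_one _ _).trans (by simp)
  | 1 => by
    rw [chainLaw, PMF.toOuterMeasure_map_apply]
    by_cases h0 : 0 ∈ S
    · have : S.filter (· < 1) = {0} := by ext a; simp; grind
      rw [this, Finset.card_singleton, pow_one]
      refine le_trans (le_of_eq ?_) hμ
      congr 1
      ext b
      simp [h0]
    · have : S.filter (· < 1) = ∅ := by ext a; simp; grind
      rw [this, Finset.card_empty, pow_zero]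
      exact toOuterMeasure_le_one _ _
  | n + 2 => by
    have ih := chainLaw_avoid_le hμ hK S (n + 1)
    rw [chainLaw, PMF.toOuterMeasure_bind_apply]
    set E := {Y : Fin (n + 1) → B | ∀ r : Fin (n + 1), (r : ℕ) ∈ S → Y r ∉ F} with hE
    have hmem : ∀ (Y : Fin (n + 1) → B) (b : B),
        (Fin.snoc (α := fun _ => B) Y b ∈ {Y | ∀ r : Fin (n + 2), (r : ℕ) ∈ S → Y r ∉ F})
          ↔ Y ∈ E ∧ (n + 1 ∈ S → b ∉ F) := by
      intro Y b
      simp only [Set.mem_ofPred_eq, hE]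
      rw [Fin.forall_fin_succ']
      simp
    -- The factor `c` of the last step is `ρ` if `n + 1 ∈ S` and `1` otherwise.
    have hstep : ∀ c : ENNReal, (∀ Y, (K Y).toOuterMeasure {b | n + 1 ∈ S → b ∉ F} ≤ c) →
        ∑' Y, chainLaw μ K (n + 1) Y * ((K (Y (Fin.last n))).map
          (fun b => Fin.snoc (α := fun _ => B) Y b)).toOuterMeasure
            {Y | ∀ r : Fin (n + 2), (r : ℕ) ∈ S → Y r ∉ F}
          ≤ ρ ^ (S.filter (· < n + 1)).card * c := by
      intro c hc
      refine le_trans ?_ (mul_le_mul_left ih c)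
      rw [PMF.toOuterMeasure_apply, ← ENNReal.tsum_mul_right]
      refine ENNReal.tsum_le_tsum fun Y => ?_
      rw [PMF.toOuterMeasure_map_apply]
      by_cases hY : Y ∈ E
      · rw [Set.indicator_of_mem hY]
        refine mul_le_mul_right ((le_of_eq ?_).trans (hc (Y (Fin.last n)))) _
        congr 1
        ext b
        rw [Set.mem_preimage, hmem]
        simp [hY]
      · rw [Set.indicator_of_notMem hY, zero_mul]
        have : (fun b => Fin.snoc (α := fun _ => B) Y b) ⁻¹'
            {Y | ∀ r : Fin (n + 2), (r : ℕ) ∈ S → Y r ∉ F} = ∅ := by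
          ext b
          rw [Set.mem_preimage, hmem]
          simp [hY]
        rw [this, MeasureTheory.measure_empty, mul_zero]
    by_cases hn : n + 1 ∈ S
    · have : S.filter (· < n + 2) = insert (n + 1) (S.filter (· < n + 1)) := by ext a; simp; grind
      rw [this, Finset.card_insert_of_notMem (by simp), pow_succ]
      refine hstep ρ fun y => (le_of_eq ?_).trans (hK y)
      congr 1
      ext b
      simp [hn]
    · have : S.filter (· < n + 2) = S.filter (· < n + 1) := by ext a; simp; grind
      rw [this]
      simpa using hstep 1 fun y => toOuterMeasure_le_one _ _

end Chain

/-! ### Decomposition of leaf words into blocks and the Markov property. -/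

section Blocks

variable {d h ℓ m : ℕ}

/-- The leaf of `T_{d,h}` that is the `j`-th leaf below the `r`-th vertex at depth `ℓ`, for
`h = ℓ + m`. -/
def subtreeEquiv (e : h = ℓ + m) : Fin (d ^ ℓ) × Fin (d ^ m) ≃ Fin (d ^ h) :=
  finProdFinEquiv.trans (finCongr (by rw [e, pow_add]))

theorem subtreeEquiv_val (e : h = ℓ + m) (r : Fin (d ^ ℓ)) (j : Fin (d ^ m)) :
    (subtreeEquiv e (r, j) : ℕ) = r * d ^ m + j := by
  simp [subtreeEquiv, add_comm, mul_comm]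

/-- The restriction of a word on the leaves of `T_{d,h}` to the leaves below the `r`-th vertex at
depth `ℓ`, for `h = ℓ + m`. -/
def subword {σ : Type*} (e : h = ℓ + m) (z : Fin (d ^ h) → σ) (r : Fin (d ^ ℓ)) :
    Fin (d ^ m) → σ :=
  fun j => z (subtreeEquiv e (r, j))

theorem block_eq_subword {σ : Type*} {w : ℕ} (hw : w ≤ h) (r : Fin (d ^ (h - w)))
    (z : Fin (d ^ h) → σ) : block hw r z = subword (Nat.sub_add_cancel hw).symm z r := by
  ext j
  exact congrArg z (Fin.ext (subtreeEquiv_val _ r j).symm)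

theorem parent_subtreeEquiv (hd : 0 < d) (r : Fin (d ^ ℓ)) (j : Fin (d ^ (m + 1))) :
    parent (subtreeEquiv (h := ℓ + m + 1) (m := m + 1) rfl (r, j))
      = subtreeEquiv (h := ℓ + m) rfl (r, parent j) := by
  apply Fin.ext
  change (subtreeEquiv (h := ℓ + m + 1) (m := m + 1) rfl (r, j) : ℕ) / d = _
  have h1 : (r : ℕ) * d ^ (m + 1) = d * (r * d ^ m) := by rw [pow_succ]; ring
  rw [subtreeEquiv_val, subtreeEquiv_val, h1, add_comm, Nat.add_mul_div_left _ _ hd, add_comm]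
  rfl

/-- Given the tokens at depth `ℓ`, the words on the leaves below these vertices are independent
samples of the broadcast process. -/
theorem language_map_subword {σ : Type*} [Fintype σ] (hd : 0 < d) (κ : σ → PMF σ) (ν : PMF σ)
    (e : h = ℓ + m) :
    (language d κ ν h).map (subword e)
      = (language d κ ν ℓ).bind fun x => piPMF fun i => language d κ (PMF.pure (x i)) m := by
  subst e
  induction m with
  | zero =>
    have h1 : ∀ x : Fin (d ^ ℓ) → σ,
        (piPMF fun i => language d κ (PMF.pure (x i)) 0) = PMF.pure fun i _ => x i := fun x => by
      simp only [language, PMF.pure_map]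
      exact piPMF_pure fun i _ => x i
    simp only [h1]
    change (language d κ ν ℓ).map _ = (language d κ ν ℓ).bind
      (PMF.pure ∘ fun (x : Fin (d ^ ℓ) → σ) (i : Fin (d ^ ℓ)) (_ : Fin (d ^ 0)) => x i)
    rw [PMF.bind_pure_comp]
    congr 1
    ext z r j
    refine congrArg z (Fin.ext ?_)
    have := j.isLt
    rw [subtreeEquiv_val]
    simp only [pow_zero] at this ⊢
    omega
  | succ m ih =>
    -- Parents stay within their subtree, so the last generation can be sampled block by block.
    have h1 : ∀ x : Fin (d ^ (ℓ + m)) → σ,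
        (piPMF fun i => κ (x (parent i))).map
            (subword (d := d) (h := ℓ + (m + 1)) (m := m + 1) rfl)
          = piPMF fun r => piPMF fun j =>
              κ (subword (h := ℓ + m) (m := m) rfl x r (parent j)) := fun x => by
      have h2 := piPMF_map_curry (subtreeEquiv (d := d) (h := ℓ + (m + 1)) (m := m + 1) rfl)
        (fun i => κ (x (parent i)))
      refine h2.trans ?_
      congr 1; ext1 r; congr 1; ext1 j; congr 2
      exact parent_subtreeEquiv hd r j
    change ((language d κ ν (ℓ + m)).bind fun x => piPMF fun i => κ (x (parent i))).map _ = _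
    rw [PMF.map_bind]
    simp only [h1]
    refine (PMF.bind_map (language d κ ν (ℓ + m)) (subword rfl)
      (fun X => piPMF fun r => piPMF fun j => κ (X r (parent j)))).symm.trans ?_
    rw [ih, PMF.bind_bind]
    congr 1
    ext1 x
    exact piPMF_bind (fun i => language d κ (PMF.pure (x i)) m)
      (fun y => piPMF fun j => κ (y (parent j)))

theorem language_map_subword_apply {σ : Type*} [Fintype σ] (hd : 0 < d) (κ : σ → PMF σ)
    (ν : PMF σ) (e : h = ℓ + m) (r : Fin (d ^ ℓ)) :
    (language d κ ν h).map (fun z => subword e z r)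
      = ((language d κ ν ℓ).map fun x => x r).bind fun a => language d κ (PMF.pure a) m := by
  have h1 := congrArg (PMF.map fun Z => Z r) (language_map_subword hd κ ν e)
  rw [PMF.map_comp, PMF.map_bind] at h1
  simp only [piPMF_map_eval] at h1
  rw [PMF.bind_map]
  exact h1

/-- Distinct blocks interact only through the colors of their roots, which is what makes
conditioning on one block tractable. -/
theorem language_map_subword_pair {σ : Type*} [Fintype σ] (hd : 0 < d) (κ : σ → PMF σ)
    (ν : PMF σ) (e : h = ℓ + m) {r s : Fin (d ^ ℓ)} (hrs : r ≠ s) :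
    (language d κ ν h).map (fun z => (subword e z r, subword e z s))
      = ((language d κ ν ℓ).map fun x => (x r, x s)).bind fun c =>
          (language d κ (PMF.pure c.1) m).bind fun u =>
            (language d κ (PMF.pure c.2) m).map fun v => (u, v) := by
  have h1 := congrArg (PMF.map fun Z => (Z r, Z s)) (language_map_subword hd κ ν e)
  rw [PMF.map_comp, PMF.map_bind] at h1
  simp only [piPMF_map_pair _ hrs] at h1
  rw [PMF.bind_map]
  exact h1

/-- Links chain times to the tree: the children of the vertex `v` at depth `h - w - 1` carry the
consecutive blocks `v * d + c`, `c < d`. -/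
theorem subword_concat {σ : Type*} {w : ℕ} (hd : 0 < d) (hw : w < h)
    (e : w + 1 = 1 + w) (v : Fin (d ^ (h - (w + 1)))) (c : Fin (d ^ 1))
    (Y : Fin (d ^ (h - w)) → Fin (d ^ w) → σ) (k : Fin (d ^ (h - w)))
    (hk : (k : ℕ) = v * d + c) :
    subword e (block (w := w + 1) hw v (concat hw.le Y)) c = Y k := by
  ext j
  have hi : ((subtreeLeaf hw v (subtreeEquiv e (c, j)) : Fin (d ^ h)) : ℕ) = k * d ^ w + j := by
    change (v : ℕ) * d ^ (w + 1) + (subtreeEquiv e (c, j) : ℕ) = _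
    rw [subtreeEquiv_val, hk, pow_succ]
    ring
  have hp : 0 < d ^ w := Nat.pow_pos hd
  simp only [subword, block, concat]
  congr 1
  · refine Fin.ext ((congrArg (· / d ^ w) hi).trans ?_)
    rw [add_comm, Nat.add_mul_div_right _ _ hp, Nat.div_eq_of_lt j.isLt, zero_add]
  · apply Fin.ext
    simp only [hi]
    rw [add_comm, Nat.add_mul_mod_self_right, Nat.mod_eq_of_lt j.isLt]

end Blocks

/-! ### Subtrees and leaf words that force the root color. -/

section Coloring

variable {d h ℓ m q : ℕ}

/-- The root of `T_{d,h}`. -/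
def root (d h : ℕ) : TreeVertex d h := ⟨0, ⟨0, by simp⟩⟩

/-- The embedding of `T_{d,m}` into `T_{d,h}`, `h = ℓ + m`, as the subtree rooted at the `r`-th
vertex at depth `ℓ`. -/
def subtreeHom (hd : 0 < d) (e : h = ℓ + m) (r : Fin (d ^ ℓ)) : treeGraph d m →g treeGraph d h where
  toFun v := ⟨⟨ℓ + v.1, by have := v.1.isLt; omega⟩, subtreeEquiv rfl (r, v.2)⟩
  map_rel' := by
    have key : ∀ u v : TreeVertex d m, IsParent u v →
        IsParent (d := d) (h := h) ⟨⟨ℓ + u.1, by have := u.1.isLt; omega⟩, subtreeEquiv rfl (r, u.2)⟩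
          ⟨⟨ℓ + v.1, by have := v.1.isLt; omega⟩, subtreeEquiv rfl (r, v.2)⟩ := by
      intro u v huv
      refine ⟨by simp only [huv.1]; omega, ?_⟩
      simp only [subtreeEquiv_val]
      have h1 : (r : ℕ) * d ^ (v.1 : ℕ) = d * (r * d ^ (u.1 : ℕ)) := by
        rw [huv.1, pow_succ]; ring
      rw [h1, add_comm _ (v.2 : ℕ), Nat.add_mul_div_left _ _ hd, huv.2, add_comm]
    rintro u v (huv | huv)
    · exact Or.inl (key u v huv)
    · exact Or.inr (key v u huv)

theorem subtreeHom_leaf (hd : 0 < d) (e : h = ℓ + m) (r : Fin (d ^ ℓ)) (j : Fin (d ^ m)) :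
    subtreeHom hd e r (leaf j) = leaf (subtreeEquiv e (r, j)) := by
  subst e
  rfl

theorem adj_root_subtreeHom_root (hd : 0 < d) (e : h = 1 + m) (c : Fin (d ^ 1)) :
    (treeGraph d h).Adj (root d h) (subtreeHom hd e c (root d m)) := by
  refine Or.inl ⟨rfl, ?_⟩
  have := c.isLt.trans_eq (pow_one d)
  change 0 = (subtreeEquiv (ℓ := 1) (m := 0) rfl (c, ⟨0, _⟩) : ℕ) / d
  rw [subtreeEquiv_val]
  simp [Nat.div_eq_of_lt this]

theorem Consistent.subword (hd : 0 < d) (e : h = ℓ + m) {z : Fin (d ^ h) → Fin q}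
    (hz : Consistent z) (r : Fin (d ^ ℓ)) : Consistent (subword e z r) := by
  obtain ⟨C, hC⟩ := hz
  refine ⟨C.comp (subtreeHom hd e r), fun i => ?_⟩
  change C (subtreeHom hd e r (leaf i)) = _
  rw [subtreeHom_leaf, hC]
  rfl

/-- Every proper coloring with the leaf colors `y` gives the root the color `a`. -/
def DeterminesRoot (a : Fin q) (y : Fin (d ^ h) → Fin q) : Prop :=
  ∀ C : (treeGraph d h).Coloring (Fin q), (∀ i, C (leaf i) = y i) → C (root d h) = a

theorem determinesRoot_const (a : Fin q) :
    DeterminesRoot (d := d) (h := 0) a fun _ => a := by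
  intro C hC
  exact hC ⟨0, by simp⟩

/-- The coloring restricts to the subtree of the child `c`, whose color is thereby forced to be `b`,
and the root is adjacent to it. -/
theorem ne_of_determinesRoot_subword (hd : 0 < d) (e : h = 1 + m) {b : Fin q}
    {z : Fin (d ^ h) → Fin q} {c : Fin (d ^ 1)} (hb : DeterminesRoot b (subword e z c))
    (C : (treeGraph d h).Coloring (Fin q)) (hC : ∀ i, C (leaf i) = z i) : C (root d h) ≠ b := by
  have h1 : C (subtreeHom hd e c (root d m)) = b :=
    hb (C.comp (subtreeHom hd e c)) fun i => by
      change C (subtreeHom hd e c (leaf i)) = _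
      rw [subtreeHom_leaf, hC]
      rfl
  rw [← h1]
  exact C.valid (adj_root_subtreeHom_root hd e c)

end Coloring

/-! ### Joint law of two vertices, or two blocks, of the same level. -/

section Pairs

theorem bind_pair_toOuterMeasure {α τ : Type*} (p : PMF α) (r : PMF τ) (u : α) (F : Set τ) :
    (p.bind fun u => r.map fun v => (u, v)).toOuterMeasure {t | t.1 = u ∧ t.2 ∈ F}
      = p u * r.toOuterMeasure F := by
  rw [PMF.toOuterMeasure_bind_apply, tsum_eq_single u]
  · rw [PMF.toOuterMeasure_map_apply]
    congr 2
    ext v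
    simp
  · intro u' hu'
    rw [PMF.toOuterMeasure_map_apply,
      show (fun v' => (u', v')) ⁻¹' {t : α × τ | t.1 = u ∧ t.2 ∈ F} = ∅ by ext; simp [hu'],
      MeasureTheory.measure_empty, mul_zero]

variable {σ : Type*} [Fintype σ] {d : ℕ}

theorem language_succ_map_apply (κ : σ → PMF σ) (ν : PMF σ) (h : ℕ) (i : Fin (d ^ (h + 1))) :
    (language d κ ν (h + 1)).map (fun x => x i)
      = ((language d κ ν h).map fun x => x (parent i)).bind κ := by
  simp only [language]
  rw [PMF.map_bind, PMF.bind_map]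
  simp only [piPMF_map_eval]
  rfl

/-- A stationary prior is the law of every token. -/
theorem language_map_apply {κ : σ → PMF σ} {ν : PMF σ} (hν : ν.bind κ = ν) (h : ℕ)
    (i : Fin (d ^ h)) : (language d κ ν h).map (fun x => x i) = ν := by
  induction h with
  | zero =>
    simp only [language]
    rw [PMF.map_comp]
    exact PMF.map_id ν
  | succ h ih => rw [language_succ_map_apply, ih, hν]

/-- If the channel is doubly stochastic and any two colors are at distance two with probability at
least `c`, then so are the colors of any two vertices of the same level. -/
theorem le_language_map_pair {κ : σ → PMF σ} {ν : PMF σ} (hν : ν.bind κ = ν)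
    (hκ : ∀ b, ∑ a, κ a b = 1) {c : ENNReal} (hc : ∀ a b, c ≤ ∑ x, ν x * (κ x b * κ x a)) (h : ℕ)
    {i j : Fin (d ^ h)} (hij : i ≠ j) (a b : σ) :
    c ≤ (language d κ ν h).map (fun x => (x i, x j)) (b, a) := by
  induction h generalizing a b with
  | zero => exact absurd (Fin.ext (by have := i.isLt; have := j.isLt; simp at *; omega)) hij
  | succ h ih =>
    have h1 : (language d κ ν (h + 1)).map (fun x => (x i, x j))
        = ((language d κ ν h).map fun x => (x (parent i), x (parent j))).bind fun t =>
            (κ t.1).bind fun u => (κ t.2).map fun v => (u, v) := by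
      simp only [language]
      rw [PMF.map_bind, PMF.bind_map]
      simp only [piPMF_map_pair _ hij]
      rfl
    rw [h1]
    -- Siblings are the case covered by `hc`. For distinct parents, the inductive bound `c` holds
    -- for all pairs of parent colors, and averaging preserves it because the columns of `κ` sum to
    -- one.
    by_cases hp : parent i = parent j
    · have h2 : ((language d κ ν h).map fun x => (x (parent i), x (parent j)))
          = ν.map fun a => (a, a) := by
        have h3 := congrArg (PMF.map fun a => (a, a)) (language_map_apply hν h (parent i))
        rw [PMF.map_comp] at h3
        rw [← hp, ← h3]
        rfl
      rw [h2, PMF.bind_map, PMF.bind_apply, tsum_fintype]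
      refine (hc a b).trans_eq (Finset.sum_congr rfl fun x _ => ?_)
      rw [Function.comp_apply, bind_pair_apply]
    · rw [PMF.bind_apply, tsum_fintype, Fintype.sum_prod_type]
      calc c = ∑ x, ∑ y, c * (κ x b * κ y a) := by
            simp only [← Finset.mul_sum, hκ, mul_one]
        _ ≤ _ := by
            refine Finset.sum_le_sum fun x _ => Finset.sum_le_sum fun y _ => ?_
            rw [bind_pair_apply]
            exact mul_le_mul_left (ih hp y x) _

/-- Given the word below a vertex, a set `F` of words is likely to be hit by the word below another
vertex of the same level, if it is likely to be hit by the broadcast process with root `a`. -/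
theorem le_language_subword_pair {h ℓ m : ℕ} (hd : 0 < d) {κ : σ → PMF σ} {ν : PMF σ}
    (hν : ν.bind κ = ν) (hκ : ∀ b, ∑ a, κ a b = 1) {t : ENNReal}
    (ht : ∀ a b, t * ν b ≤ ∑ x, ν x * (κ x b * κ x a)) (hu : ∀ a b, ν a = ν b)
    (e : h = ℓ + m) {r s : Fin (d ^ ℓ)}
    (hrs : r ≠ s) {a : σ} {f : ENNReal} {F : Set (Fin (d ^ m) → σ)}
    (hF : f ≤ (language d κ (PMF.pure a) m).toOuterMeasure F) (y : Fin (d ^ m) → σ) :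
    t * f * (language d κ ν h).toOuterMeasure {z | subword e z r = y}
      ≤ (language d κ ν h).toOuterMeasure {z | subword e z r = y ∧ subword e z s ∈ F} := by
  have h1 : (language d κ ν h).toOuterMeasure {z | subword e z r = y}
      = ∑ x, ν x * language d κ (PMF.pure x) m y := by
    have := congrArg (fun p => p y) (language_map_subword_apply hd κ ν e r)
    simp only [language_map_apply hν, PMF.bind_apply, tsum_fintype,
      map_apply_eq_toOuterMeasure] at this
    exact this
  have h2 : (language d κ ν h).toOuterMeasure {z | subword e z r = y ∧ subword e z s ∈ F}
      = ∑ x, ∑ x', (language d κ ν ℓ).map (fun z => (z r, z s)) (x, x') *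
          (language d κ (PMF.pure x) m y *
            (language d κ (PMF.pure x') m).toOuterMeasure F) := by
    have := congrArg (fun p => p.toOuterMeasure {t | t.1 = y ∧ t.2 ∈ F})
      (language_map_subword_pair hd κ ν e hrs)
    simp only [PMF.toOuterMeasure_map_apply, PMF.toOuterMeasure_bind_apply, tsum_fintype,
      Fintype.sum_prod_type] at this
    refine this.trans (Finset.sum_congr rfl fun x _ => Finset.sum_congr rfl fun x' _ => ?_)
    rw [← bind_pair_toOuterMeasure, PMF.toOuterMeasure_bind_apply, tsum_fintype]
    simp only [PMF.toOuterMeasure_map_apply]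
  rw [h1, h2, Finset.mul_sum]
  refine Finset.sum_le_sum fun x _ => ?_
  -- Only the event that the second root has color `a` is kept.
  refine le_trans ?_ (Finset.single_le_sum (f := fun x' =>
    (language d κ ν ℓ).map (fun z => (z r, z s)) (x, x') *
          (language d κ (PMF.pure x) m y *
            (language d κ (PMF.pure x') m).toOuterMeasure F))
    (fun _ _ => zero_le) (Finset.mem_univ a))
  have h3 : t * ν x ≤ (language d κ ν ℓ).map (fun z => (z r, z s)) (x, a) :=
    le_language_map_pair hν hκ (fun a b => (ht a b).trans' (by rw [hu b x])) ℓ hrs a x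
  calc t * f * (ν x * language d κ (PMF.pure x) m y)
      = t * ν x * (language d κ (PMF.pure x) m y * f) := by ring
    _ ≤ _ := by gcongr

end Pairs

/-! ### Lower bounds for the initial and transition laws. -/

section Transition

variable {σ : Type*} [Fintype σ] {d h w : ℕ}

theorem le_firstBlockLaw {κ : σ → PMF σ} {ν : PMF σ} (hd : 2 ≤ d) (hw : w < h)
    (hν : ν.bind κ = ν) {a : σ} {f t : ENNReal} {F : Set (Fin (d ^ w) → σ)} (ht : t ≤ ν a)
    (hF : f ≤ (language d κ (PMF.pure a) w).toOuterMeasure F) :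
    t * f ≤ (firstBlockLaw κ ν hd hw).toOuterMeasure F := by
  have h1 := language_map_subword_apply (by omega : 0 < d) κ ν (Nat.sub_add_cancel hw.le).symm
    ⟨0, Nat.zero_lt_one.trans (one_lt_pow_sub hd hw)⟩
  have h2 : firstBlockLaw κ ν hd hw = ν.bind fun a => language d κ (PMF.pure a) w := by
    rw [language_map_apply hν] at h1
    rw [← h1, firstBlockLaw]
    congr 1
    ext1 z
    exact block_eq_subword hw.le _ z
  rw [h2, PMF.toOuterMeasure_bind_apply]
  refine le_trans ?_ (ENNReal.le_tsum a)
  gcongr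

/-- The bound of `le_language_subword_pair` is the same for all pairs of distinct vertices, so it
survives both the conditioning on the height and the averaging over it. -/
theorem le_nextBlockLaw {κ : σ → PMF σ} {ν : PMF σ} (hd : 2 ≤ d) (hw : w < h)
    (hν : ν.bind κ = ν) (hκ : ∀ b, ∑ a, κ a b = 1) {t : ENNReal}
    (ht : ∀ a b, t * ν b ≤ ∑ x, ν x * (κ x b * κ x a)) (hu : ∀ a b, ν a = ν b)
    {a : σ} (hta : t ≤ ν a) {f : ENNReal} {F : Set (Fin (d ^ w) → σ)}
    (hF : f ≤ (language d κ (PMF.pure a) w).toOuterMeasure F) (y : Fin (d ^ w) → σ) :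
    t * f ≤ (nextBlockLaw κ ν hd hw y).toOuterMeasure F := by
  rw [nextBlockLaw, PMF.toOuterMeasure_bind_apply]
  calc t * f = ∑' m, heightLaw hd hw m * (t * f) := by
        rw [ENNReal.tsum_mul_right, PMF.tsum_coe, one_mul]
    _ ≤ _ := by
        refine ENNReal.tsum_le_tsum fun m => mul_le_mul_right ?_ _
        split_ifs with hm
        · refine le_filter_map_toOuterMeasure _ _ hm _ _ _ ?_
          simp only [adjacentBlocksLaw, PMF.toOuterMeasure_bind_apply,
            PMF.toOuterMeasure_map_apply]
          rw [← ENNReal.tsum_mul_left]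
          -- The joint law is a mixture over adjacent positions `i`, so the inequality is checked
          -- for each `i`; positions with the wrong height contribute zero to the left side.
          refine ENNReal.tsum_le_tsum fun i => ?_
          rw [mul_left_comm]
          refine mul_le_mul_right ?_ _
          by_cases hi : lcaHeight d i (i + 1) = m
          · have := le_language_subword_pair (by omega : 0 < d) hν hκ ht hu
              (Nat.sub_add_cancel hw.le).symm
              (r := ⟨i, by have := i.isLt; omega⟩) (s := ⟨i + 1, by have := i.isLt; omega⟩)
              (by simp) hF y
            refine le_trans (le_of_eq ?_) (this.trans (le_of_eq ?_))
            · congr 2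
              ext z
              simp only [Set.mem_preimage, Set.mem_ofPred_eq, block_eq_subword, hi, true_and]
            · congr 1
              ext z
              simp only [Set.mem_preimage, Set.mem_inter_iff, Set.mem_ofPred_eq,
                block_eq_subword, hi, true_and]
          · refine le_trans (le_of_eq ?_) zero_le
            rw [mul_eq_zero]
            right
            convert MeasureTheory.measure_empty (μ := (language d κ ν h).toOuterMeasure)
            ext z
            simp [hi]
        -- The default value on null conditions obeys the same bound, so `y` need not be a word that
        -- the process can produce.
        · exact le_firstBlockLaw hd hw hν hta hF

end Transition

/-! ### The coloring channel, the freezing recursion and the union bound. -/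

section ColoringProcess

variable {q d h w : ℕ}

theorem coloringChannel_apply (hq : 2 ≤ q) (a b : Fin q) :
    coloringChannel hq a b = if b = a then 0 else ((q - 1 : ℕ) : ENNReal)⁻¹ := by
  rw [coloringChannel, PMF.uniformOfFinset_apply]
  by_cases hb : b = a <;> simp [hb, Finset.card_erase_of_mem]

theorem coloringPrior_apply (hq : 2 ≤ q) (a : Fin q) : coloringPrior hq a = (q : ENNReal)⁻¹ := by
  simp [coloringPrior]

theorem sum_coloringChannel (hq : 2 ≤ q) (b : Fin q) : ∑ a, coloringChannel hq a b = 1 := by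
  have h1 : ∀ a, coloringChannel hq a b = coloringChannel hq b a := fun a => by
    simp only [coloringChannel_apply, eq_comm]
  simp only [h1]
  exact (tsum_fintype _).symm.trans (coloringChannel hq b).tsum_coe

theorem coloringPrior_bind (hq : 2 ≤ q) :
    (coloringPrior hq).bind (coloringChannel hq) = coloringPrior hq := by
  ext b
  rw [PMF.bind_apply, tsum_fintype]
  simp only [coloringPrior_apply]
  rw [← Finset.mul_sum, sum_coloringChannel, mul_one]

/-- A lower bound on the probability that a color turns into another given one in two steps of the
coloring channel. -/
def twoStep (q : ℕ) : ENNReal := ENNReal.ofReal (((q : ℝ) - 2) / ((q : ℝ) - 1) ^ 2)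

/-- At least `q - 2` intermediate colors differ from both `a` and `b`, and each contributes `(q -
1)⁻¹ ^ 2`. -/
theorem twoStep_le_sum (hq : 2 ≤ q) (a b : Fin q) :
    twoStep q ≤ ∑ x, coloringChannel hq x b * coloringChannel hq x a := by
  have hq1 : (0 : ℝ) < (q : ℝ) - 1 := by
    have : (2 : ℝ) ≤ q := by exact_mod_cast hq
    linarith
  have hinv : ((q - 1 : ℕ) : ENNReal)⁻¹ = ENNReal.ofReal (((q : ℝ) - 1)⁻¹) := by
    rw [ENNReal.ofReal_inv_of_pos hq1, ← ENNReal.ofReal_natCast, Nat.cast_sub (by omega),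
      Nat.cast_one]
  have hcard : q - 2 ≤ (Finset.univ \ {a, b} : Finset (Fin q)).card := by
    have h1 := Finset.le_card_sdiff ({a, b} : Finset (Fin q)) Finset.univ
    have h2 := Finset.card_le_two (a := a) (b := b)
    rw [Finset.card_univ, Fintype.card_fin] at h1
    omega
  calc twoStep q
      = ((q - 2 : ℕ) : ENNReal) * (((q - 1 : ℕ) : ENNReal)⁻¹ * ((q - 1 : ℕ) : ENNReal)⁻¹) := by
        rw [hinv, ← ENNReal.ofReal_mul (by positivity), ← ENNReal.ofReal_natCast (q - 2),
          ← ENNReal.ofReal_mul (by positivity), Nat.cast_sub hq, twoStep]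
        congr 1
        field_simp
        simp
    _ ≤ ((Finset.univ \ {a, b} : Finset (Fin q)).card : ENNReal) *
          (((q - 1 : ℕ) : ENNReal)⁻¹ * ((q - 1 : ℕ) : ENNReal)⁻¹) := by
        gcongr
    _ = ∑ x ∈ (Finset.univ \ {a, b} : Finset (Fin q)),
          coloringChannel hq x b * coloringChannel hq x a := by
        rw [← nsmul_eq_mul, ← Finset.sum_const]
        refine Finset.sum_congr rfl fun x hx => ?_
        simp only [Finset.mem_sdiff, Finset.mem_univ, Finset.mem_insert, Finset.mem_singleton,
          true_and, not_or] at hx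
        rw [coloringChannel_apply, coloringChannel_apply, if_neg (Ne.symm hx.1),
          if_neg (Ne.symm hx.2)]
    _ ≤ _ := Finset.sum_le_sum_of_subset (Finset.subset_univ _)

theorem twoStep_le_coloringPrior (hq : 2 ≤ q) (a : Fin q) : twoStep q ≤ coloringPrior hq a := by
  have hq2 : (2 : ℝ) ≤ q := by exact_mod_cast hq
  rw [coloringPrior_apply, ← ENNReal.ofReal_natCast, ← ENNReal.ofReal_inv_of_pos (by linarith),
    twoStep]
  apply ENNReal.ofReal_le_ofReal
  rw [inv_eq_one_div, div_le_div_iff₀ (by nlinarith) (by linarith)]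
  nlinarith

/-- If `x` is large enough, then the leaves of the broadcast process fail to determine the color of
the root with probability at most `x`, for every height. -/
theorem not_determinesRoot_le (hq : 2 ≤ q) (hd : 0 < d) {x : ENNReal}
    (hx : (q : ENNReal) * (1 - (q : ENNReal)⁻¹ * (1 - x)) ^ d ≤ x) (h : ℕ) (a : Fin q) :
    (language d (coloringChannel hq) (PMF.pure a) h).toOuterMeasure {y | DeterminesRoot a y}ᶜ
      ≤ x := by
  induction h generalizing a with
  | zero =>
    simp only [language, PMF.pure_map]
    rw [PMF.toOuterMeasure_pure_apply, if_neg]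
    · exact zero_le
    · exact fun hc => hc (determinesRoot_const a)
  | succ m ih =>
    have e : m + 1 = 1 + m := add_comm _ _
    set T := (coloringChannel hq a).bind fun b => language d (coloringChannel hq) (PMF.pure b) m
      with hT
    have hlaw : (language d (coloringChannel hq) (PMF.pure a) (m + 1)).map (subword e)
        = piPMF fun _ => T := by
      rw [language_map_subword hd]
      simp only [language, PMF.pure_map, PMF.pure_bind]
      exact piPMF_bind (fun _ : Fin (d ^ 1) => coloringChannel hq a)
        fun b => language d (coloringChannel hq) (PMF.pure b) m
    have hTb : ∀ b, b ≠ a → T.toOuterMeasure {y | DeterminesRoot b y}ᶜ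
        ≤ 1 - (q : ENNReal)⁻¹ * (1 - x) := by
      intro b hb
      rw [toOuterMeasure_compl]
      refine tsub_le_tsub_left ?_ _
      rw [hT, PMF.toOuterMeasure_bind_apply]
      refine le_trans ?_ (ENNReal.le_tsum b)
      refine mul_le_mul' ?_ (le_toOuterMeasure_of_compl_le (ih b))
      -- The channel gives `1 / (q - 1)`, which is weakened to `1 / q`.
      rw [coloringChannel_apply, if_neg hb]
      gcongr
      omega
    -- If the root is not forced to be `a`, some coloring gives it a color `b ≠ a`, and then no
    -- child is forced to be `b`.
    have hsub : ({y | DeterminesRoot a y}ᶜ : Set (Fin (d ^ (m + 1)) → Fin q))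
        ⊆ ⋃ b ∈ Finset.univ.erase a,
          subword e ⁻¹' (Set.univ.pi fun _ => {y | DeterminesRoot b y}ᶜ) := by
      intro z hz
      by_contra hcon
      refine hz fun C hC => ?_
      by_contra hne
      refine hcon ?_
      simp only [Set.mem_iUnion]
      refine ⟨C (root d (m + 1)), by simpa using hne, fun c _ hc => ?_⟩
      exact ne_of_determinesRoot_subword hd e hc C hC rfl
    calc _ ≤ ∑ b ∈ Finset.univ.erase a,
          (language d (coloringChannel hq) (PMF.pure a) (m + 1)).toOuterMeasure
            (subword e ⁻¹' (Set.univ.pi fun _ => {y | DeterminesRoot b y}ᶜ)) :=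
          (MeasureTheory.measure_mono hsub).trans (MeasureTheory.measure_biUnion_finset_le _ _)
      _ ≤ ∑ b ∈ Finset.univ.erase a, (1 - (q : ENNReal)⁻¹ * (1 - x)) ^ d := by
          refine Finset.sum_le_sum fun b hb => ?_
          rw [← PMF.toOuterMeasure_map_apply, hlaw, piPMF_toOuterMeasure_pi, Finset.prod_const,
            Finset.card_univ, Fintype.card_fin, pow_one]
          exact pow_le_pow_left' (hTb b (Finset.ne_of_mem_erase hb)) d
      _ ≤ ∑ b : Fin q, (1 - (q : ENNReal)⁻¹ * (1 - x)) ^ d :=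
          Finset.sum_le_sum_of_subset (Finset.subset_univ _)
      _ ≤ x := by simpa using hx

/-- The autoregressive coloring process is unlikely to leave a valid color to a vertex at depth
`h - w - 1`. -/
theorem consistent_block_le (hq : 2 ≤ q) (hd : 2 ≤ d) (hw : w < h) {x : ENNReal}
    (hx : (q : ENNReal) * (1 - (q : ENNReal)⁻¹ * (1 - x)) ^ d ≤ x) (v : Fin (d ^ (h - (w + 1)))) :
    (autoregressiveColoringLaw hq hd hw).toOuterMeasure
        {z | Consistent (block (w := w + 1) hw v z)}
      ≤ q * (1 - twoStep q * (1 - x)) ^ d := by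
  have hd0 : 0 < d := by omega
  have e : w + 1 = 1 + w := add_comm _ _
  have hpow : d ^ (h - w) = d ^ (h - (w + 1)) * d := by
    rw [← pow_succ]
    congr 1
    omega
  have hv : v * d + d ≤ d ^ (h - w) := by
    rw [hpow, ← Nat.succ_mul]
    exact Nat.mul_le_mul_right d v.isLt
  set S := Finset.Ico ((v : ℕ) * d) (v * d + d) with hS
  have hcard : (S.filter (· < d ^ (h - w))).card = d := by
    rw [Finset.filter_true_of_mem, hS, Nat.card_Ico]
    · omega
    · intro r hr
      rw [hS, Finset.mem_Ico] at hr
      omega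
  set avoid : Fin q → Set (Fin (d ^ (h - w)) → Fin (d ^ w) → Fin q) := fun b =>
    {Y | ∀ r : Fin (d ^ (h - w)), (r : ℕ) ∈ S → Y r ∉ {y | DeterminesRoot b y}} with havoid
  -- The color of `v` in a proper coloring is one that no block below `v` forces.
  have hsub : concat hw.le ⁻¹' {z | Consistent (block (w := w + 1) hw v z)}
      ⊆ ⋃ b ∈ (Finset.univ : Finset (Fin q)), avoid b := by
    rintro Y ⟨C, hC⟩
    simp only [Set.mem_iUnion]
    refine ⟨C (root d (w + 1)), Finset.mem_univ _, fun r hr hdet => ?_⟩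
    rw [hS, Finset.mem_Ico] at hr
    have hc := subword_concat hd0 hw e v ⟨r - v * d, by rw [pow_one]; omega⟩ Y r
      (by simp only; omega)
    rw [← hc] at hdet
    exact ne_of_determinesRoot_subword hd0 e hdet C hC rfl
  have hstep : ∀ b, (chainLaw (firstBlockLaw (coloringChannel hq) (coloringPrior hq) hd hw)
      (nextBlockLaw (coloringChannel hq) (coloringPrior hq) hd hw)
        (d ^ (h - w))).toOuterMeasure (avoid b) ≤ (1 - twoStep q * (1 - x)) ^ d := by
    intro b
    have hF := le_toOuterMeasure_of_compl_le (not_determinesRoot_le hq hd0 hx w b)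
    have hchain := chainLaw_avoid_le (F := {y | DeterminesRoot b y})
      (ρ := 1 - twoStep q * (1 - x))
      (μ := firstBlockLaw (coloringChannel hq) (coloringPrior hq) hd hw)
      (K := nextBlockLaw (coloringChannel hq) (coloringPrior hq) hd hw) ?_ ?_ S (d ^ (h - w))
    · rwa [hcard] at hchain
    · rw [toOuterMeasure_compl]
      exact tsub_le_tsub_left (le_firstBlockLaw hd hw (coloringPrior_bind hq)
        (twoStep_le_coloringPrior hq b) hF) _
    · intro y
      rw [toOuterMeasure_compl]
      refine tsub_le_tsub_left (le_nextBlockLaw hd hw (coloringPrior_bind hq)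
        (sum_coloringChannel hq) ?_ ?_ (twoStep_le_coloringPrior hq b) hF y) _
      · intro a b
        simp only [coloringPrior_apply]
        rw [← Finset.mul_sum, mul_comm]
        gcongr
        exact twoStep_le_sum hq a b
      · intro a b
        simp only [coloringPrior_apply]
  rw [autoregressiveColoringLaw, autoregressiveLaw, PMF.toOuterMeasure_map_apply]
  calc _ ≤ ∑ b : Fin q, (chainLaw (firstBlockLaw (coloringChannel hq) (coloringPrior hq) hd hw)
        (nextBlockLaw (coloringChannel hq) (coloringPrior hq) hd hw)
          (d ^ (h - w))).toOuterMeasure (avoid b) :=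
        (MeasureTheory.measure_mono hsub).trans (MeasureTheory.measure_biUnion_finset_le _ _)
    _ ≤ ∑ b : Fin q, (1 - twoStep q * (1 - x)) ^ d := Finset.sum_le_sum fun b _ => hstep b
    _ = q * (1 - twoStep q * (1 - x)) ^ d := by simp

end ColoringProcess

/-! ### Asymptotics at the threshold. -/

section Estimates

theorem natCast_mul_one_sub_pow_le (q d : ℕ) {s : ℝ} (hs : 0 ≤ s) :
    (q : ENNReal) * (1 - ENNReal.ofReal s) ^ d ≤ ENNReal.ofReal (q * Real.exp (-(s * d))) := by
  have h1 : 1 - ENNReal.ofReal s ≤ ENNReal.ofReal (Real.exp (-s)) := by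
    rw [← ENNReal.ofReal_one, ← ENNReal.ofReal_sub _ hs]
    exact ENNReal.ofReal_le_ofReal (Real.one_sub_le_exp_neg s)
  have h2 : Real.exp (-(s * d)) = Real.exp (-s) ^ d := by
    rw [← Real.exp_nat_mul]
    congr 1
    ring
  rw [h2, ENNReal.ofReal_mul (by positivity), ENNReal.ofReal_natCast,
    ENNReal.ofReal_pow (by positivity)]
  gcongr

/-- The correction term in the threshold. -/
def thresholdError (q : ℕ) : ℝ := (Real.log (Real.log q) + 1) / (Real.log q - 1)

/-- With `L = log q`, the term `thresholdError q` is the solution `ε` of `(1 - 1 / L) (L + log L + 1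
+ ε) = L + log L`; the factor `1 - 1 / L` is `1 - x` for `x = 1 / L`. -/
theorem log_add_loglog_le {q d : ℕ} (hL : 1 < Real.log q) (hq : 0 < (q : ℝ))
    (hd : (q : ℝ) * (Real.log q + Real.log (Real.log q) + 1 + thresholdError q) < d) :
    Real.log q + Real.log (Real.log q) ≤ (q : ℝ)⁻¹ * (1 - (Real.log q)⁻¹) * d := by
  have h1 : Real.log q + Real.log (Real.log q)
      = (1 - (Real.log q)⁻¹) *
        (Real.log q + Real.log (Real.log q) + 1 + thresholdError q) := by
    have : Real.log q - 1 ≠ 0 := by linarith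
    have : Real.log q ≠ 0 := by linarith
    rw [thresholdError]
    field_simp
    ring
  have h2 : 0 ≤ 1 - (Real.log q)⁻¹ := by
    have := inv_le_one_of_one_le₀ hL.le
    linarith
  have h3 : Real.log q + Real.log (Real.log q) + 1 + thresholdError q ≤ (q : ℝ)⁻¹ * d := by
    rw [inv_mul_eq_div, le_div_iff₀ hq]
    linarith
  calc _ = _ := h1
    _ ≤ (1 - (Real.log q)⁻¹) * ((q : ℝ)⁻¹ * d) := by gcongr
    _ = _ := by ring

theorem mul_exp_neg_log_add_loglog {q : ℝ} (hq : 0 < q) (hL : 0 < Real.log q) :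
    q * Real.exp (-(Real.log q + Real.log (Real.log q))) = (Real.log q)⁻¹ := by
  rw [neg_add, Real.exp_add, Real.exp_neg, Real.exp_neg, Real.exp_log hq, Real.exp_log hL,
    mul_inv_cancel_left₀ hq.ne']

theorem tendsto_thresholdError : Filter.Tendsto thresholdError Filter.atTop (nhds 0) := by
  have hL : Filter.Tendsto (fun q : ℕ => Real.log q) Filter.atTop Filter.atTop :=
    Real.tendsto_log_atTop.comp tendsto_natCast_atTop_atTop
  have h1 : Filter.Tendsto (fun L : ℝ => (Real.log L + 1) / (L - 1)) Filter.atTop (nhds 0) := by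
    have h2 : (fun L : ℝ => Real.log L + 1) =o[Filter.atTop] fun L : ℝ => L :=
      Real.isLittleO_log_id_atTop.add (Asymptotics.isLittleO_const_id_atTop 1)
    have h3 : (fun L : ℝ => L) =O[Filter.atTop] fun L : ℝ => L - 1 := by
      refine Asymptotics.IsBigO.of_bound 2 ?_
      filter_upwards [Filter.eventually_ge_atTop 2] with L hL
      rw [Real.norm_of_nonneg (by linarith), Real.norm_of_nonneg (by linarith)]
      linarith
    exact (h2.trans_isBigO h3).tendsto_div_nhds_zero
  exact h1.comp hL

theorem le_prob_of_compl_le {α : Type*} {p : PMF α} {s : Set α} {δ : ℝ} (hδ : 0 ≤ δ)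
    (hs : p.toOuterMeasure s ≤ ENNReal.ofReal δ) : 1 - δ ≤ prob p sᶜ := by
  have h1 : 1 - ENNReal.ofReal δ ≤ p.toOuterMeasure sᶜ :=
    le_toOuterMeasure_of_compl_le (by rwa [compl_compl])
  rw [← ENNReal.ofReal_one, ← ENNReal.ofReal_sub _ hδ] at h1
  exact (ENNReal.ofReal_le_iff_le_toReal (ne_top_of_le_ne_top ENNReal.one_ne_top
    (toOuterMeasure_le_one p _))).1 h1

theorem consistent_block_le_inv_log {q d h w : ℕ} (hq : 2 ≤ q) (hd : 2 ≤ d) (hw : w < h)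
    (hL : 1 < Real.log q)
    (hdq : (q : ℝ) * (Real.log q + Real.log (Real.log q) + 1 + thresholdError q) < d)
    (v : Fin (d ^ (h - (w + 1)))) :
    (autoregressiveColoringLaw hq hd hw).toOuterMeasure
        {z | Consistent (block (w := w + 1) hw v z)}
      ≤ ENNReal.ofReal (Real.exp 2 / Real.log q) := by
  have hq2 : (2 : ℝ) ≤ q := by exact_mod_cast hq
  have hq0 : (0 : ℝ) < q := by linarith
  have hL0 : 0 < Real.log q := by linarith
  have hLL : 0 ≤ Real.log (Real.log q) := Real.log_nonneg hL.le
  have hbase := log_add_loglog_le hL hq0 hdq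
  have hx1 : 0 ≤ 1 - (Real.log q)⁻¹ := by
    have := inv_le_one_of_one_le₀ hL.le
    linarith
  have hT0 : 0 ≤ ((q : ℝ) - 2) / ((q : ℝ) - 1) ^ 2 := div_nonneg (by linarith) (by positivity)
  have hsub : 1 - ENNReal.ofReal ((Real.log q)⁻¹) = ENNReal.ofReal (1 - (Real.log q)⁻¹) := by
    rw [ENNReal.ofReal_sub _ (by positivity), ENNReal.ofReal_one]
  -- The value `x = 1 / log q` is admissible in the freezing recursion, since `q exp (-(log q + log
  -- log q)) = 1 / log q`.
  have hx : (q : ENNReal) * (1 - (q : ENNReal)⁻¹ * (1 - ENNReal.ofReal ((Real.log q)⁻¹))) ^ d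
      ≤ ENNReal.ofReal ((Real.log q)⁻¹) := by
    rw [hsub, ← ENNReal.ofReal_natCast q, ← ENNReal.ofReal_inv_of_pos hq0,
      ← ENNReal.ofReal_mul (by positivity), ENNReal.ofReal_natCast]
    refine (natCast_mul_one_sub_pow_le q d (by positivity)).trans (ENNReal.ofReal_le_ofReal ?_)
    refine le_trans ?_ (mul_exp_neg_log_add_loglog hq0 hL0).le
    gcongr
  refine (consistent_block_le hq hd hw hx v).trans ?_
  rw [hsub, twoStep, ← ENNReal.ofReal_mul hT0]
  refine (natCast_mul_one_sub_pow_le q d (by positivity)).trans (ENNReal.ofReal_le_ofReal ?_)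
  -- Passing from `1 / q` to `twoStep q` multiplies the exponent by `c = q (q - 2) / (q - 1) ^ 2`.
  -- This costs at most `2` in the exponent, hence the factor `exp 2` in the final bound.
  have hloop : Real.log q + Real.log (Real.log q) - 2
      ≤ ((q : ℝ) - 2) / ((q : ℝ) - 1) ^ 2 * (1 - (Real.log q)⁻¹) * d := by
    have hq1 : (0 : ℝ) < (q : ℝ) - 1 := by linarith
    set A := (q : ℝ)⁻¹ * (1 - (Real.log q)⁻¹) * d with hA
    set c := 1 - 1 / ((q : ℝ) - 1) ^ 2 with hc
    have h1 : ((q : ℝ) - 2) / ((q : ℝ) - 1) ^ 2 * (1 - (Real.log q)⁻¹) * d = c * A := by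
      rw [hA, hc]
      field_simp
      ring
    have hc0 : 0 ≤ c := by
      rw [hc, sub_nonneg, div_le_one (by positivity)]
      nlinarith
    have h2 : c * (Real.log q + Real.log (Real.log q)) ≤ c * A := by gcongr
    have h3 : 1 / ((q : ℝ) - 1) ^ 2 * (Real.log q + Real.log (Real.log q)) ≤ 2 := by
      have h4 : Real.log q ≤ (q : ℝ) - 1 := Real.log_le_sub_one_of_pos hq0
      have h5 : Real.log (Real.log q) ≤ Real.log q - 1 := Real.log_le_sub_one_of_pos hL0
      rw [one_div_mul_eq_div, div_le_iff₀ (by positivity)]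
      nlinarith
    rw [h1]
    have h6 : c * (Real.log q + Real.log (Real.log q)) = Real.log q + Real.log (Real.log q)
        - 1 / ((q : ℝ) - 1) ^ 2 * (Real.log q + Real.log (Real.log q)) := by
      rw [hc]; ring
    linarith
  calc _ ≤ (q : ℝ) * Real.exp (-(Real.log q + Real.log (Real.log q) - 2)) := by gcongr
    _ = (q * Real.exp (-(Real.log q + Real.log (Real.log q)))) * Real.exp 2 := by
        rw [mul_assoc, ← Real.exp_add]
        congr 2
        ring
    _ = Real.exp 2 / Real.log q := by
        rw [mul_exp_neg_log_add_loglog hq0 hL0, inv_mul_eq_div]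

end Estimates

end Broadcast

end

theorem theorem3 :
    ∃ ε δ : ℕ → ℝ,
      Filter.Tendsto ε Filter.atTop (nhds 0) ∧
      Filter.Tendsto δ Filter.atTop (nhds 0) ∧
      ∀ (q d h w : ℕ) (hq : 2 ≤ q) (hd : 2 ≤ d) (hw : w < h),
        (q : ℝ) * (Real.log q + Real.log (Real.log q) + 1 + ε q) < (d : ℝ) →
        1 - δ q ≤ Broadcast.prob (Broadcast.autoregressiveColoringLaw (q := q) hq hd hw)
            {z | ¬ Broadcast.Consistent z} ∧
        ∀ v : Fin (d ^ (h - (w + 1))),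
          1 - δ q ≤ Broadcast.prob (Broadcast.autoregressiveColoringLaw (q := q) hq hd hw)
            {z | ¬ Broadcast.Consistent (Broadcast.block (w := w + 1) hw v z)} := by
  refine ⟨Broadcast.thresholdError, fun q => Real.exp 2 / Real.log q,
    Broadcast.tendsto_thresholdError,
    (Real.tendsto_log_atTop.comp tendsto_natCast_atTop_atTop).const_div_atTop (Real.exp 2), ?_⟩
  intro q d h w hq hd hw hdq
  have hL0 : 0 < Real.log q := Real.log_pos (by exact_mod_cast hq)
  have hδ : 0 ≤ Real.exp 2 / Real.log q := by positivity
  rcases le_or_gt (Real.log q) 1 with hL | hL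
  -- Here `q = 2`, and the bound is vacuous because `exp 2 / log q ≥ 1`.
  · have h1 : 1 - Real.exp 2 / Real.log q ≤ 0 := by
      rw [sub_nonpos, le_div_iff₀ hL0, one_mul]
      exact hL.trans (Real.one_le_exp (by norm_num))
    exact ⟨h1.trans ENNReal.toReal_nonneg, fun v => h1.trans ENNReal.toReal_nonneg⟩
  · have key := Broadcast.consistent_block_le_inv_log hq hd hw hL hdq
    refine ⟨?_, fun v => Broadcast.le_prob_of_compl_le hδ (key v)⟩
    -- Global consistency implies consistency below the leftmost vertex at depth `h - w - 1`.
    refine Broadcast.le_prob_of_compl_le hδ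
      (le_trans (MeasureTheory.measure_mono fun z hz => ?_) (key ⟨0, Nat.pow_pos (by omega)⟩))
    rw [Set.mem_ofPred_eq, Broadcast.block_eq_subword]
    exact Broadcast.Consistent.subword (by omega) _ hz _
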